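/- For a finite simple graph $G$, a drawing of $G$ in the plane represents the vertices by distinct points of $\mathbb{R}^2$ and each edge by a simple arc joining the points of its two ends and passing through no other vertex. The crossing number $\mathrm{cr}(G)$ is the minimum, over all drawings of $G$ in the plane, of the number of pairwise intersections of edges, that is, of pairs $(\{e,f\},p)$ where $e \neq f$ are edges and $p$ is a common point of their arcs that is not a vertex. The $n$-dimensional folded hypercube $FQ_n$ is the graph whose vertices are the binary strings of length $n$, two distinct strings being adjacent if they differ in exactly one bit or if they are bitwise complements of each other. Theorem. For every integer $n \ge 3$, $$\mathrm{cr}(FQ_n) \le \frac{11}{32}\,4^n - (n^2+3n)\,2^{n-3}.$$ -/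

import Mathlib

/-- The `n`-dimensional hypercube: binary strings of length `n`, adjacent when they differ in
exactly one bit. -/
def hypercube (n : ℕ) : SimpleGraph (Fin n → Bool) where
  Adj x y := hammingDist x y = 1
  symm := ⟨fun x y h => by rw [hammingDist_comm]; exact h⟩
  loopless := ⟨fun x h => by simp at h⟩

/-- The `n`-dimensional folded hypercube: the hypercube together with all complementary edges,
which join each string `x` to its bitwise complement. -/
def foldedHypercube (n : ℕ) : SimpleGraph (Fin n → Bool) :=
  hypercube n ⊔ SimpleGraph.fromRel (fun x y => y = fun i => !(x i))

/-- A drawing of a graph in the plane: vertices are distinct points, every edge is a simple arc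
(the image of a continuous injective map of `[0,1]`) joining the points of its two ends, and an
edge passes through no vertex other than its ends. -/
structure PlaneDrawing {V : Type*} (G : SimpleGraph V) where
  /-- the point that represents a vertex -/
  vert : V → ℝ × ℝ
  /-- the closed arc that represents an edge -/
  arc : G.edgeSet → Set (ℝ × ℝ)
  vert_injective : Function.Injective vert
  isArc : ∀ e : G.edgeSet, ∃ γ : unitInterval → ℝ × ℝ, Continuous γ ∧ Function.Injective γ ∧
    Set.range γ = arc e ∧ s(γ 0, γ 1) = Sym2.map vert (e : Sym2 V)
  vert_mem_arc : ∀ (e : G.edgeSet) (v : V), vert v ∈ arc e → v ∈ (e : Sym2 V)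

/-- The pairwise intersections of edges in a drawing: an unordered pair of distinct edges together
with a common point of their arcs that is not a vertex. A point common to `k` edges is thus counted
once for each of the `k.choose 2` pairs, and a pair of edges once for each common point. -/
def PlaneDrawing.crossings {V : Type*} {G : SimpleGraph V} (D : PlaneDrawing G) :
    Set (Sym2 G.edgeSet × (ℝ × ℝ)) :=
  {c | ¬ c.1.IsDiag ∧ (∀ e ∈ c.1, c.2 ∈ D.arc e) ∧ c.2 ∉ Set.range D.vert}

/-- The crossing number: the minimum number of pairwise intersections of edges in a drawing
(`⊤` if no drawing has finitely many). -/
noncomputable def crossingNumber {V : Type*} (G : SimpleGraph V) : ℕ∞ :=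
  ⨅ D : PlaneDrawing G, D.crossings.encard

/-! The drawings are two-page book drawings, built by doubling. `FQ_{n+1}` arises from `FQ_n` by
splitting every vertex into two adjacent copies: a hypercube edge lifts to two edges between equal
copies, a complementary edge to two edges between opposite copies. Put the copies side by side on
the spine and keep the pages. An old crossing yields four (`card_crossingQuads_double_le`), two
edges of one page with a common end yield one, and the two lifts of an edge cross or not according
to the order of the copies at its ends.

Ordering the copies by bit parity nests the lifts of all hypercube edges; those of complementary
edges cross only for odd `n`, costing at most `2^(n-1)`. Placing each new edge on the less used page
keeps the pages balanced at every vertex (`IsBalanced.double`), which keeps the number of forks near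
`n^2 * 2^n / 4`. The recurrence preserves the bound from `n = 4` on; explicit drawings settle `n =
3` and `n = 4`. -/

/-- A two-page book drawing: the vertices lie on a line and every edge is assigned to one of the
two half-planes bounded by it. -/
structure BookDrawing {V : Type*} (G : SimpleGraph V) where
  /-- the position of a vertex on the spine -/
  pos : V → ℕ
  /-- the half-plane that contains an edge -/
  page : V → V → Bool
  pos_injective : Function.Injective pos
  page_comm : ∀ u v, page u v = page v u

/-! ### Book drawings as plane drawings with parabolic arcs -/

namespace BookDrawing

variable {V : Type*} {G : SimpleGraph V}

/-- `D.Crosses a b c d` says that `ab` and `cd` are edges on the same page whose ends alternate in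
the order `a, c, b, d` along the spine. -/
def Crosses (D : BookDrawing G) (a b c d : V) : Prop :=
  G.Adj a b ∧ G.Adj c d ∧ D.pos a < D.pos c ∧ D.pos c < D.pos b ∧ D.pos b < D.pos d ∧
    D.page a b = D.page c d

open Classical in
/-- The pairs of crossing edges of a book drawing, each listed once. -/
noncomputable def crossingQuads [Fintype V] (D : BookDrawing G) : Finset (V × V × V × V) :=
  Finset.univ.filter fun q => D.Crosses q.1 q.2.1 q.2.2.1 q.2.2.2

/-- The sign of the ordinates in a half-plane. -/
def pageSign (b : Bool) : ℝ := if b then 1 else -1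

lemma pageSign_ne_zero (b : Bool) : pageSign b ≠ 0 := by
  cases b <;> norm_num [pageSign]

/-- The parabolic arc over (or under) the interval `[a, b]`. -/
def parabolicArc (s a b : ℝ) : Set (ℝ × ℝ) :=
  {p | a ≤ p.1 ∧ p.1 ≤ b ∧ p.2 = s * ((p.1 - a) * (b - p.1))}

/-- The arc that represents an edge. -/
def edgeArc (D : BookDrawing G) (e : Sym2 V) : Set (ℝ × ℝ) :=
  {p | ∃ a b, s(a, b) = e ∧ D.pos a < D.pos b ∧
    p ∈ parabolicArc (pageSign (D.page a b)) (D.pos a) (D.pos b)}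

lemma edgeArc_mk (D : BookDrawing G) {a b : V} (h : D.pos a < D.pos b) :
    D.edgeArc s(a, b) = parabolicArc (pageSign (D.page a b)) (D.pos a) (D.pos b) := by
  ext p
  constructor
  · rintro ⟨c, d, hcd, hlt, hp⟩
    rcases Sym2.eq_iff.1 hcd with ⟨rfl, rfl⟩ | ⟨rfl, rfl⟩
    · exact hp
    · omega
  · exact fun hp => ⟨a, b, rfl, h, hp⟩

lemma exists_ordered_ends (D : BookDrawing G) (e : G.edgeSet) :
    ∃ a b, (e : Sym2 V) = s(a, b) ∧ G.Adj a b ∧ D.pos a < D.pos b := by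
  obtain ⟨e, he⟩ := e
  induction e using Sym2.ind with
  | _ a b =>
    have hab : G.Adj a b := he
    rcases lt_trichotomy (D.pos a) (D.pos b) with h | h | h
    · exact ⟨a, b, rfl, hab, h⟩
    · exact absurd (D.pos_injective h) hab.ne
    · exact ⟨b, a, Sym2.eq_swap, hab.symm, h⟩

lemma eq_end_of_mem_parabolicArc {s a b x : ℝ} (hs : s ≠ 0)
    (h : (x, (0 : ℝ)) ∈ parabolicArc s a b) : x = a ∨ x = b := by
  obtain ⟨-, -, h⟩ := h
  simp only [zero_eq_mul, mul_eq_zero, hs, false_or] at h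
  rcases h with h | h
  · left; linarith
  · right; linarith

/-- The plane drawing with the vertices on the first axis and the edges as parabolic arcs. -/
def toPlaneDrawing (D : BookDrawing G) : PlaneDrawing G where
  vert v := (D.pos v, 0)
  arc e := D.edgeArc e
  vert_injective u v h := D.pos_injective (by simpa using h)
  isArc e := by
    obtain ⟨a, b, he, -, hlt⟩ := D.exists_ordered_ends e
    have hlt' : (D.pos a : ℝ) < D.pos b := by exact_mod_cast hlt
    have hpos : (0 : ℝ) < D.pos b - D.pos a := by linarith
    refine ⟨fun t => (D.pos a + (D.pos b - D.pos a) * (t : ℝ), pageSign (D.page a b) *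
      (((D.pos b - D.pos a) * t) * ((D.pos b - D.pos a) * (1 - t)))), by fun_prop, ?_, ?_, ?_⟩
    · intro t u h
      have h1 := (Prod.ext_iff.1 h).1
      simp only [add_right_inj, mul_eq_mul_left_iff, hpos.ne', or_false] at h1
      exact Subtype.ext h1
    · rw [he, edgeArc_mk D hlt]
      ext ⟨x, y⟩
      constructor
      · rintro ⟨t, ht⟩
        have h1 := (Prod.ext_iff.1 ht).1
        have h2 := (Prod.ext_iff.1 ht).2
        simp only at h1 h2
        have h3 := mul_nonneg hpos.le t.2.1
        have h4 := mul_nonneg hpos.le (sub_nonneg.2 t.2.2)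
        refine ⟨by simp only; linarith, by simp only; linarith, ?_⟩
        simp only
        rw [← h2, ← h1]
        ring
      · rintro ⟨h1, h2, h3⟩
        simp only at h1 h2 h3
        refine ⟨⟨(x - D.pos a) / (D.pos b - D.pos a), div_nonneg (by linarith) hpos.le,
          (div_le_one hpos).2 (by linarith)⟩, ?_⟩
        rw [h3]
        refine Prod.ext ?_ ?_ <;> simp only <;> field_simp <;> ring
    · rw [he]
      simp
  vert_mem_arc e v h := by
    obtain ⟨a, b, he, -, hlt⟩ := D.exists_ordered_ends e
    rw [he, edgeArc_mk D hlt] at h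
    rw [he, Sym2.mem_iff]
    rcases eq_end_of_mem_parabolicArc (pageSign_ne_zero _) h with h | h
    · exact Or.inl (D.pos_injective (by exact_mod_cast h))
    · exact Or.inr (D.pos_injective (by exact_mod_cast h))

/-- Two parabolic arcs on the same side meet off the spine only if their ends alternate. -/
lemma alternate_of_mem_parabolicArcs {s a b c d : ℝ} {p : ℝ × ℝ} (hs : s ≠ 0)
    (h : p ∈ parabolicArc s a b) (h' : p ∈ parabolicArc s c d) (hp : p.2 ≠ 0)
    (hne : ¬(a = c ∧ b = d)) : (a < c ∧ c < b ∧ b < d) ∨ (c < a ∧ a < d ∧ d < b) := by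
  obtain ⟨h1, h2, h3⟩ := h
  obtain ⟨h4, h5, h6⟩ := h'
  have hz : (p.1 - a) * (b - p.1) = (p.1 - c) * (d - p.1) :=
    mul_left_cancel₀ hs (h3.symm.trans h6)
  have hn : (p.1 - a) * (b - p.1) ≠ 0 := fun h0 => hp (by rw [h3, h0, mul_zero])
  have hn' : (p.1 - c) * (d - p.1) ≠ 0 := hz ▸ hn
  have g1 := lt_of_le_of_ne (sub_nonneg.2 h1) (left_ne_zero_of_mul hn).symm
  have g2 := lt_of_le_of_ne (sub_nonneg.2 h2) (right_ne_zero_of_mul hn).symm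
  have g3 := lt_of_le_of_ne (sub_nonneg.2 h4) (left_ne_zero_of_mul hn').symm
  have g4 := lt_of_le_of_ne (sub_nonneg.2 h5) (right_ne_zero_of_mul hn').symm
  rcases lt_trichotomy a c with hac | hac | hac
  · left
    refine ⟨hac, by linarith, ?_⟩
    -- If the second interval were nested in the first, its arc would be strictly lower at this
    -- abscissa.
    by_contra hbd
    have : (p.1 - c) * (d - p.1) < (p.1 - a) * (b - p.1) :=
      mul_lt_mul (by linarith) (by linarith) g4 (by linarith)
    linarith
  · subst hac
    have := mul_left_cancel₀ g1.ne' hz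
    exact absurd ⟨rfl, by linarith⟩ hne
  · right
    refine ⟨hac, by linarith, ?_⟩
    by_contra hbd
    have : (p.1 - a) * (b - p.1) < (p.1 - c) * (d - p.1) :=
      mul_lt_mul (by linarith) (by linarith) g2 (by linarith)
    linarith

/-- Two parabolic arcs with alternating ends meet in at most one point. -/
lemma eq_of_mem_parabolicArcs {s a b c d : ℝ} {p q : ℝ × ℝ} (hs : s ≠ 0)
    (hp : p ∈ parabolicArc s a b) (hp' : p ∈ parabolicArc s c d)
    (hq : q ∈ parabolicArc s a b) (hq' : q ∈ parabolicArc s c d) (hac : a < c) (hbd : b < d) :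
    p = q := by
  obtain ⟨-, -, h1⟩ := hp
  obtain ⟨-, -, h2⟩ := hp'
  obtain ⟨-, -, h3⟩ := hq
  obtain ⟨-, -, h4⟩ := hq'
  have e1 := mul_left_cancel₀ hs (h1.symm.trans h2)
  have e2 := mul_left_cancel₀ hs (h3.symm.trans h4)
  have hx : p.1 = q.1 := by
    -- The quadratic terms cancel, leaving a linear equation with positive leading coefficient.
    have : (c + d - a - b) * (p.1 - q.1) = 0 := by linear_combination e2 - e1
    rcases mul_eq_zero.1 this with h | h <;> linarith
  exact Prod.ext hx (by rw [h1, h3, hx])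

lemma exists_crosses_of_mem_crossings (D : BookDrawing G)
    {c : Sym2 G.edgeSet × (ℝ × ℝ)} (hc : c ∈ D.toPlaneDrawing.crossings) :
    ∃ q : V × V × V × V, D.Crosses q.1 q.2.1 q.2.2.1 q.2.2.2 ∧
      c.1.map (Subtype.val : G.edgeSet → Sym2 V) = s(s(q.1, q.2.1), s(q.2.2.1, q.2.2.2)) ∧
      c.2 ∈ D.edgeArc s(q.1, q.2.1) ∧ c.2 ∈ D.edgeArc s(q.2.2.1, q.2.2.2) := by
  obtain ⟨ef, p⟩ := c
  induction ef using Sym2.ind with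
  | _ e f =>
    obtain ⟨hef, hmem, hv⟩ := hc
    have hpe : p ∈ D.edgeArc e := hmem e (by simp)
    have hpf : p ∈ D.edgeArc f := hmem f (by simp)
    have hne : (e : Sym2 V) ≠ f := fun h => hef (by simpa using Subtype.ext h)
    obtain ⟨a, b, he, hab, hlt⟩ := D.exists_ordered_ends e
    obtain ⟨c, d, hf, hcd, hlt'⟩ := D.exists_ordered_ends f
    simp only [Sym2.map_mk, he, hf]
    rw [he] at hpe
    rw [hf] at hpf
    have hpe' := hpe
    have hpf' := hpf
    rw [edgeArc_mk D hlt] at hpe'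
    rw [edgeArc_mk D hlt'] at hpf'
    have hp0 : p.2 ≠ 0 := by
      intro h0
      have hp : p = (p.1, 0) := Prod.ext rfl h0
      rw [hp] at hpe'
      rcases eq_end_of_mem_parabolicArc (pageSign_ne_zero _) hpe' with h | h
      · exact hv ⟨a, by rw [hp, h]; rfl⟩
      · exact hv ⟨b, by rw [hp, h]; rfl⟩
    have hpage : D.page a b = D.page c d := by
      -- Arcs on opposite pages have ordinates of opposite sign, so they meet only on the spine.
      by_contra hpg
      obtain ⟨h1, h2, h3⟩ := hpe'
      obtain ⟨h4, h5, h6⟩ := hpf'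
      have k1 := mul_nonneg (sub_nonneg.2 h1) (sub_nonneg.2 h2)
      have k2 := mul_nonneg (sub_nonneg.2 h4) (sub_nonneg.2 h5)
      apply hp0
      revert h3 h6 hpg
      cases D.page a b <;> cases D.page c d <;> simp [pageSign] <;> intros <;> linarith
    rw [← hpage] at hpf'
    have hends : ¬((D.pos a : ℝ) = D.pos c ∧ (D.pos b : ℝ) = D.pos d) := by
      rintro ⟨h1, h2⟩
      have h1' := D.pos_injective (Nat.cast_injective h1)
      have h2' := D.pos_injective (Nat.cast_injective h2)
      exact hne (by rw [he, hf, h1', h2'])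
    rcases alternate_of_mem_parabolicArcs (pageSign_ne_zero _) hpe' hpf' hp0 hends with h | h
    · simp only [Nat.cast_lt] at h
      exact ⟨(a, b, c, d), ⟨hab, hcd, h.1, h.2.1, h.2.2, hpage⟩, rfl, hpe, hpf⟩
    · simp only [Nat.cast_lt] at h
      exact ⟨(c, d, a, b), ⟨hcd, hab, h.1, h.2.1, h.2.2, hpage.symm⟩, Sym2.eq_swap, hpf, hpe⟩

/-- The quadruple of a crossing point recovers both edges, and arcs with alternating ends meet at
most once, so geometric crossings inject into combinatorial ones. -/
theorem crossingNumber_le [Fintype V] (D : BookDrawing G) :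
    crossingNumber G ≤ (D.crossingQuads.card : ℕ∞) := by
  refine (iInf_le _ D.toPlaneDrawing).trans ?_
  choose g hg1 hg2 hg3 hg4 using fun c (hc : c ∈ D.toPlaneDrawing.crossings) =>
    D.exists_crosses_of_mem_crossings hc
  rw [← Set.encard_coe_eq_coe_finsetCard]
  refine Function.Embedding.encard_le ⟨fun c => ⟨g c c.2, ?_⟩, ?_⟩
  · simpa [crossingQuads] using hg1 c c.2
  · rintro ⟨c, hc⟩ ⟨c', hc'⟩ h
    replace h : g c hc = g c' hc' := congrArg Subtype.val h
    refine Subtype.ext (Prod.ext ?_ ?_)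
    · exact Sym2.map.injective Subtype.val_injective ((hg2 c hc).trans (h ▸ (hg2 c' hc').symm))
    · obtain ⟨-, -, h1, h2, h3, hpg⟩ := hg1 c hc
      have hx := hg3 c hc
      have hy := hg4 c hc
      have hx' := hg3 c' hc'
      have hy' := hg4 c' hc'
      rw [← h] at hx' hy'
      rw [edgeArc_mk D (h1.trans h2)] at hx hx'
      rw [edgeArc_mk D (h2.trans h3), ← hpg] at hy hy'
      exact eq_of_mem_parabolicArcs (pageSign_ne_zero _) hx hy hx' hy'
        (by exact_mod_cast h1) (by exact_mod_cast h3)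

end BookDrawing

/-! ### Doubling a book drawing -/

namespace BookDrawing

open Classical in
/-- The pairs of edges that share the end `v` and lie on the same page, as triples `(v, p, q)`
with `p` before `q`. -/
noncomputable def forks {V : Type*} [Fintype V] {G : SimpleGraph V} (D : BookDrawing G) :
    Finset (V × V × V) :=
  Finset.univ.filter fun t => G.Adj t.1 t.2.1 ∧ G.Adj t.1 t.2.2 ∧ D.pos t.2.1 < D.pos t.2.2 ∧
    D.page t.1 t.2.1 = D.page t.1 t.2.2

open Classical in
/-- The neighbours joined to `v` by an edge on page `β`. -/
noncomputable def pageNeighbors {V : Type*} [Fintype V] {G : SimpleGraph V} (D : BookDrawing G)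
    (v : V) (β : Bool) : Finset V :=
  Finset.univ.filter fun p => G.Adj v p ∧ D.page v p = β

/-- A fork is determined by its vertex, its page and an unordered pair of neighbours on that page.
-/
lemma card_forks_le {V : Type*} [Fintype V] {G : SimpleGraph V} (D : BookDrawing G) (k : ℕ)
    (hk : ∀ v, (D.pageNeighbors v true).card.choose 2 + (D.pageNeighbors v false).card.choose 2
      ≤ k) : D.forks.card ≤ Fintype.card V * k := by
  classical
  have hmap : D.forks.card ≤ (Finset.univ.sigma fun v : V =>
      (Finset.univ : Finset Bool).sigma fun β => (D.pageNeighbors v β).powersetCard 2).card := by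
    refine Finset.card_le_card_of_injOn
      (fun t => ⟨t.1, D.page t.1 t.2.1, {t.2.1, t.2.2}⟩) ?_ ?_
    · rintro ⟨v, p, q⟩ h
      simp only [forks, Finset.coe_filter, Finset.mem_univ, true_and, Set.mem_ofPred_eq] at h
      obtain ⟨h1, h2, h3, h4⟩ := h
      have hne : p ≠ q := by rintro rfl; exact lt_irrefl _ h3
      simp [Finset.mem_powersetCard, Finset.insert_subset_iff, pageNeighbors, h1, h2, h4,
        Finset.card_pair hne]
    · rintro ⟨v, p, q⟩ h ⟨v', p', q'⟩ h' heq
      simp only [forks, Finset.coe_filter, Finset.mem_univ, true_and, Set.mem_ofPred_eq] at h h'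
      obtain ⟨-, -, h3, -⟩ := h
      obtain ⟨-, -, h3', -⟩ := h'
      simp only [Sigma.mk.injEq] at heq
      obtain ⟨rfl, heq⟩ := heq
      simp only [heq_eq_eq, Sigma.mk.injEq] at heq
      have hs := heq.2
      have hp : p ∈ ({p', q'} : Finset V) := hs ▸ by simp
      have hq : q ∈ ({p', q'} : Finset V) := hs ▸ by simp
      simp only [Finset.mem_insert, Finset.mem_singleton] at hp hq
      rcases hp with rfl | rfl <;> rcases hq with rfl | rfl
      · omega
      · rfl
      · omega
      · omega
  refine hmap.trans ?_
  rw [Finset.card_sigma]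
  refine (Finset.sum_le_card_nsmul _ _ k fun v _ => ?_).trans (by simp)
  simpa [Finset.card_sigma, Finset.card_powersetCard] using hk v

variable {V W : Type*} {G : SimpleGraph V} {H : SimpleGraph W}

/-- `H` arises from `G` by splitting each vertex into two adjacent copies and each edge `uv` into
two disjoint edges, which join equal copies if `δ u v` is false and different ones otherwise. -/
def IsTwistedDouble (G : SimpleGraph V) (H : SimpleGraph W) (e : W ≃ V × Bool)
    (δ : V → V → Bool) : Prop :=
  ∀ x y, H.Adj x y ↔ ((e x).1 = (e y).1 ∧ (e x).2 ≠ (e y).2) ∨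
    (G.Adj (e x).1 (e y).1 ∧ (e y).2 = xor (e x).2 (δ (e x).1 (e y).1))

/-- Replace each vertex by two consecutive ones, in the order prescribed by `σ`, with the new edges
on the pages prescribed by `q`. -/
noncomputable def double (D : BookDrawing G) (H : SimpleGraph W) (e : W ≃ V × Bool)
    (σ q : V → Bool) : BookDrawing H where
  -- Copy `i` of `v` comes first exactly when `i = σ v`.
  pos x := 2 * D.pos (e x).1 + (xor (e x).2 (σ (e x).1)).toNat
  page x y := open Classical in
    if (e x).1 = (e y).1 then q (e x).1 else D.page (e x).1 (e y).1
  pos_injective x y h := by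
    have hx := Bool.toNat_le (xor (e x).2 (σ (e x).1))
    have hy := Bool.toNat_le (xor (e y).2 (σ (e y).1))
    simp only at h
    have h1 : (e x).1 = (e y).1 := D.pos_injective (by omega)
    rw [h1] at h
    have h2 : (xor (e x).2 (σ (e y).1)).toNat = (xor (e y).2 (σ (e y).1)).toNat := by omega
    refine e.injective (Prod.ext h1 ?_)
    revert h2
    cases (e x).2 <;> cases (e y).2 <;> cases σ (e y).1 <;> simp
  page_comm x y := by
    by_cases h : (e x).1 = (e y).1
    · simp [h]
    · simp [h, Ne.symm h, D.page_comm (e x).1]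

section double

variable {e : W ≃ V × Bool} {σ q : V → Bool} {δ : V → V → Bool}

lemma double_pos_lt_iff (D : BookDrawing G) {x y : W} :
    (D.double H e σ q).pos x < (D.double H e σ q).pos y ↔ D.pos (e x).1 < D.pos (e y).1 ∨
      ((e x).1 = (e y).1 ∧ (e x).2 = σ (e x).1 ∧ (e y).2 = !σ (e y).1) := by
  have hx := Bool.toNat_le (xor (e x).2 (σ (e x).1))
  have hy := Bool.toNat_le (xor (e y).2 (σ (e y).1))
  simp only [double]
  rcases lt_trichotomy (D.pos (e x).1) (D.pos (e y).1) with h | h | h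
  · simp only [h, true_or, iff_true]; omega
  · have h1 := D.pos_injective h
    rw [h1]
    cases (e x).2 <;> cases (e y).2 <;> cases σ (e y).1 <;> simp
  · have : (e x).1 ≠ (e y).1 := fun h' => by rw [h'] at h; exact lt_irrefl _ h
    simp only [this, false_and, or_false]
    omega

/-- The copies of one vertex are consecutive on the spine, so the edge joining them crosses nothing;
both crossing edges are lifts of edges of `G`. -/
lemma Crosses.of_double {D : BookDrawing G} (hH : IsTwistedDouble G H e δ) {x y z w : W}
    (h : (D.double H e σ q).Crosses x y z w) :
    G.Adj (e x).1 (e y).1 ∧ (e y).2 = xor (e x).2 (δ (e x).1 (e y).1) ∧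
    G.Adj (e z).1 (e w).1 ∧ (e w).2 = xor (e z).2 (δ (e z).1 (e w).1) ∧
    D.page (e x).1 (e y).1 = D.page (e z).1 (e w).1 := by
  obtain ⟨h1, h2, h3, h4, h5, h6⟩ := h
  have key : ∀ {s t u : W}, (D.double H e σ q).pos s < (D.double H e σ q).pos u →
      (D.double H e σ q).pos u < (D.double H e σ q).pos t → (e s).1 ≠ (e t).1 := by
    intro s t u hsu hut hst
    have k1 := Bool.toNat_le (xor (e s).2 (σ (e s).1))
    have k2 := Bool.toNat_le (xor (e t).2 (σ (e t).1))
    have k3 := Bool.toNat_le (xor (e u).2 (σ (e u).1))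
    simp only [double] at hsu hut
    rw [← hst] at hut k2
    have k4 : (e s).1 = (e u).1 := D.pos_injective (by omega)
    rw [← k4] at *
    omega
  have n1 := key h3 h4
  have n2 := key h4 h5
  rcases (hH x y).1 h1 with ⟨h, -⟩ | ⟨a1, a2⟩
  · exact absurd h n1
  rcases (hH z w).1 h2 with ⟨h, -⟩ | ⟨b1, b2⟩
  · exact absurd h n2
  refine ⟨a1, a2, b1, b2, ?_⟩
  simpa [double, n1, n2] using h6

open Classical in
/-- The edges whose two copies cross in the doubled drawing. -/
noncomputable def twistedEdges [Fintype V] (D : BookDrawing G) (σ : V → Bool)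
    (δ : V → V → Bool) : Finset (V × V) :=
  Finset.univ.filter fun t => G.Adj t.1 t.2 ∧ D.pos t.1 < D.pos t.2 ∧
    σ t.2 = xor (σ t.1) (δ t.1 t.2)

open Classical in
/-- Crossings of the doubled drawing, according to the coincidences among the ends in the original
drawing. -/
theorem card_crossingQuads_double_le [Fintype V] [Fintype W] (D : BookDrawing G)
    (hH : IsTwistedDouble G H e δ) : (D.double H e σ q).crossingQuads.card ≤
      4 * D.crossingQuads.card + D.forks.card + (D.twistedEdges σ δ).card := by
  set Q := (D.double H e σ q).crossingQuads with hQ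
  let T : Finset ((V × V × V × V) × Bool × Bool ⊕ (V × V × V) ⊕ (V × V)) :=
    (D.crossingQuads ×ˢ Finset.univ).disjSum (D.forks.disjSum (D.twistedEdges σ δ))
  -- Only ends consecutive in the crossing order can be copies of one vertex. Without coincidences,
  -- two bits fix the lifts, whence the factor 4. At a coincidence the order of the two copies fixes
  -- all bits, so none is recorded; for a fork, the place of the shared vertex relative to the other
  -- two tells the three cases apart.
  let f : W × W × W × W → (V × V × V × V) × Bool × Bool ⊕ (V × V × V) ⊕ (V × V) :=
    fun t => if (e t.1).1 = (e t.2.2.1).1 then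
        if (e t.2.1).1 = (e t.2.2.2).1 then .inr (.inr ((e t.1).1, (e t.2.1).1))
        else .inr (.inl ((e t.1).1, (e t.2.1).1, (e t.2.2.2).1))
      else if (e t.2.2.1).1 = (e t.2.1).1 then
        .inr (.inl ((e t.2.1).1, (e t.1).1, (e t.2.2.2).1))
      else if (e t.2.1).1 = (e t.2.2.2).1 then
        .inr (.inl ((e t.2.1).1, (e t.1).1, (e t.2.2.1).1))
      else .inl (((e t.1).1, (e t.2.1).1, (e t.2.2.1).1, (e t.2.2.2).1), (e t.1).2, (e t.2.2.1).2)
  have hT : T.card = 4 * D.crossingQuads.card + D.forks.card + (D.twistedEdges σ δ).card := by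
    simp [T, Finset.card_disjSum]
    ring
  rw [← hT]
  refine Finset.card_le_card_of_injOn f ?_ ?_
  · rintro ⟨x, y, z, w⟩ ht
    have hc : (D.double H e σ q).Crosses x y z w := by simpa [hQ, crossingQuads] using ht
    obtain ⟨a1, a2, b1, b2, hp⟩ := hc.of_double hH
    obtain ⟨-, -, h3, h4, h5, -⟩ := hc
    rw [double_pos_lt_iff] at h3 h4 h5
    have n1 := a1.ne
    have n2 := b1.ne
    have k1 := D.page_comm (e x).1 (e y).1
    have k2 := D.page_comm (e z).1 (e w).1
    have k3 := a1.symm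
    have k4 := b1.symm
    simp only [f]
    generalize e x = x', e y = y', e z = z', e w = w' at *
    split_ifs with c1 c2 c3 c4 <;>
      simp only [T, Finset.mem_coe, Finset.inl_mem_disjSum,
        Finset.inr_mem_disjSum, Finset.mem_product, forks, twistedEdges, crossingQuads, Crosses,
        Finset.mem_filter, Finset.mem_univ, true_and, and_true]
    all_goals grind
  · rintro ⟨x, y, z, w⟩ ht ⟨x', y', z', w'⟩ ht' heq
    have hc : (D.double H e σ q).Crosses x y z w := by simpa [hQ, crossingQuads] using ht
    have hc' : (D.double H e σ q).Crosses x' y' z' w' := by simpa [hQ, crossingQuads] using ht'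
    obtain ⟨a1, a2, b1, b2, -⟩ := hc.of_double hH
    obtain ⟨-, -, h3, h4, h5, -⟩ := hc
    obtain ⟨a1', a2', b1', b2', -⟩ := hc'.of_double hH
    obtain ⟨-, -, h3', h4', h5', -⟩ := hc'
    rw [double_pos_lt_iff] at h3 h4 h5 h3' h4' h5'
    replace a1 := a1.ne
    replace b1 := b1.ne
    replace a1' := a1'.ne
    replace b1' := b1'.ne
    simp only [f] at heq
    simp only [Prod.mk.injEq]
    simp only [← e.injective.eq_iff]
    clear hQ ht ht'
    generalize e x = x, e y = y, e z = z, e w = w, e x' = x', e y' = y', e z' = z', e w' = w' at *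
    obtain ⟨x, i⟩ := x
    obtain ⟨y, j⟩ := y
    obtain ⟨z, k⟩ := z
    obtain ⟨w, l⟩ := w
    obtain ⟨x', i'⟩ := x'
    obtain ⟨y', j'⟩ := y'
    obtain ⟨z', k'⟩ := z'
    obtain ⟨w', l'⟩ := w'
    simp only [Prod.mk.injEq] at *
    have a3 : i = xor j (δ x y) := by simp [a2]
    have b3 : k = xor l (δ z w) := by simp [b2]
    have a3' : i' = xor j' (δ x' y') := by simp [a2']
    have b3' : k' = xor l' (δ z' w') := by simp [b2']
    split_ifs at heq <;>
      simp only [Sum.inl.injEq, Sum.inr.injEq, Prod.mk.injEq, reduceCtorEq] at heq <;>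
      grind

end double

end BookDrawing

/-! ### Balanced pages -/

namespace BookDrawing

section double

variable {V W : Type*} {G : SimpleGraph V} {H : SimpleGraph W} {e : W ≃ V × Bool}
  {σ q : V → Bool} {δ : V → V → Bool}

lemma card_pageNeighbors_double [Fintype V] [Fintype W] (D : BookDrawing G)
    (hH : IsTwistedDouble G H e δ) (x : W) (β : Bool) :
    ((D.double H e σ q).pageNeighbors x β).card =
      (D.pageNeighbors (e x).1 β).card + if q (e x).1 = β then 1 else 0 := by
  classical
  have h : (D.double H e σ q).pageNeighbors x β =
      (D.pageNeighbors (e x).1 β).image (fun p => e.symm (p, xor (e x).2 (δ (e x).1 p))) ∪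
        if q (e x).1 = β then {e.symm ((e x).1, !(e x).2)} else ∅ := by
    ext y
    obtain ⟨⟨b, j⟩, rfl⟩ := e.symm.surjective y
    simp only [pageNeighbors, Finset.mem_union, Finset.mem_image, Finset.mem_filter,
      Finset.mem_univ, true_and, hH x, double, e.apply_symm_apply, e.symm.injective.eq_iff]
    by_cases hb : (e x).1 = b
    · subst hb
      by_cases hq : q (e x).1 = β <;> simp [hq] <;> cases j <;>
        cases (e x).2 <;> simp
    · have hb' : b ≠ (e x).1 := Ne.symm hb
      by_cases hq : q (e x).1 = β <;> simp [hq, hb, hb'] <;> grind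
  rw [h, Finset.card_union_of_disjoint, Finset.card_image_of_injective]
  · split_ifs <;> simp
  · intro p p' hp
    exact (Prod.ext_iff.1 (e.symm.injective hp)).1
  · rw [Finset.disjoint_left]
    rintro y hy hy'
    obtain ⟨p, hp, rfl⟩ := Finset.mem_image.1 hy
    split_ifs at hy'
    · have hp' := (Prod.ext_iff.1 (e.symm.injective (Finset.mem_singleton.1 hy'))).1
      simp only at hp'
      subst hp'
      simp [pageNeighbors] at hp
    · simp at hy'

/-- All vertices have degree `d`, and their edges are divided between the pages as evenly as
possible. -/
def IsBalanced [Fintype V] (D : BookDrawing G) (d : ℕ) : Prop :=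
  ∀ v, (D.pageNeighbors v true).card + (D.pageNeighbors v false).card = d ∧
    (D.pageNeighbors v true).card ≤ (D.pageNeighbors v false).card + 1 ∧
    (D.pageNeighbors v false).card ≤ (D.pageNeighbors v true).card + 1

/-- The new edge at each vertex goes to the page with fewer edges, so the difference never exceeds
one. -/
lemma IsBalanced.double [Fintype V] [Fintype W] {D : BookDrawing G} {d : ℕ} (hD : D.IsBalanced d)
    (hH : IsTwistedDouble G H e δ) : (D.double H e σ fun v => decide
      ((D.pageNeighbors v true).card ≤ (D.pageNeighbors v false).card)).IsBalanced (d + 1) := by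
  intro x
  obtain ⟨h1, h2, h3⟩ := hD (e x).1
  rw [D.card_pageNeighbors_double hH, D.card_pageNeighbors_double hH]
  by_cases h : (D.pageNeighbors (e x).1 true).card ≤ (D.pageNeighbors (e x).1 false).card
  · simp only [h, decide_true, if_true, Bool.true_eq_false, if_false]
    omega
  · simp only [h, decide_false, if_true, Bool.false_eq_true, if_false]
    omega

lemma IsBalanced.card_forks_le [Fintype V] {D : BookDrawing G} {d : ℕ} (hD : D.IsBalanced d) :
    D.forks.card ≤ Fintype.card V * ((d / 2).choose 2 + ((d + 1) / 2).choose 2) := by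
  refine D.card_forks_le _ fun v => ?_
  obtain ⟨h1, h2, h3⟩ := hD v
  generalize (D.pageNeighbors v true).card = s at *
  generalize (D.pageNeighbors v false).card = t at *
  rcases le_total s t with h | h
  · rw [show d / 2 = s by omega, show (d + 1) / 2 = t by omega]
  · rw [show d / 2 = t by omega, show (d + 1) / 2 = s by omega, add_comm]

end double

end BookDrawing

/-! ### The folded hypercube as a twisted double -/

section FoldedHypercube

variable {n : ℕ}

/-- The bitwise complement of a binary string. -/
def bitCompl (x : Fin n → Bool) : Fin n → Bool := fun i => !x i

@[simp]
lemma bitCompl_bitCompl (x : Fin n → Bool) : bitCompl (bitCompl x) = x := by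
  funext i
  simp [bitCompl]

lemma hammingDist_bitCompl (x : Fin n → Bool) : hammingDist x (bitCompl x) = n := by
  simp [hammingDist, bitCompl]

lemma foldedHypercube_adj_iff (hn : n ≠ 0) {x y : Fin n → Bool} :
    (foldedHypercube n).Adj x y ↔ hammingDist x y = 1 ∨ y = bitCompl x := by
  simp only [foldedHypercube, hypercube, SimpleGraph.sup_adj, SimpleGraph.fromRel_adj]
  refine or_congr_right ?_
  change (x ≠ y ∧ (y = bitCompl x ∨ x = bitCompl y)) ↔ y = bitCompl x
  constructor
  · rintro ⟨-, rfl | rfl⟩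
    · rfl
    · simp
  · rintro rfl
    refine ⟨fun h => hn ?_, Or.inl rfl⟩
    have := hammingDist_bitCompl x
    rwa [← h, hammingDist_self, eq_comm] at this

/-- Split off the first bit of a binary string. -/
def splitFirstBit (n : ℕ) : (Fin (n + 1) → Bool) ≃ (Fin n → Bool) × Bool where
  toFun x := (fun i => x i.succ, x 0)
  invFun p := Fin.cons p.2 p.1
  left_inv x := by
    funext i
    refine Fin.cases ?_ (fun _ => ?_) i <;> simp
  right_inv p := by simp

lemma hammingDist_succ (x y : Fin (n + 1) → Bool) :
    hammingDist x y = (if x 0 = y 0 then 0 else 1) +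
      hammingDist (splitFirstBit n x).1 (splitFirstBit n y).1 := by
  simp only [hammingDist, Finset.card_filter, Fin.sum_univ_succ]
  simp only [ne_eq, ite_not]
  rfl

lemma eq_bitCompl_succ_iff (x y : Fin (n + 1) → Bool) :
    y = bitCompl x ↔ (splitFirstBit n y).1 = bitCompl (splitFirstBit n x).1 ∧ y 0 = !x 0 := by
  simp only [funext_iff, Fin.forall_fin_succ, bitCompl, splitFirstBit, Equiv.coe_fn_mk]
  tauto

/-- The first bit labels the copy; complementing a string flips it, which is the twist. For `n = 1`
complementary and hypercube edges would coincide, hence `2 ≤ n`. -/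
lemma isTwistedDouble_foldedHypercube (hn : 2 ≤ n) :
    BookDrawing.IsTwistedDouble (foldedHypercube n) (foldedHypercube (n + 1)) (splitFirstBit n)
      (fun u v => decide (v = bitCompl u)) := by
  intro x y
  rw [foldedHypercube_adj_iff (by omega), foldedHypercube_adj_iff (by omega), hammingDist_succ,
    eq_bitCompl_succ_iff]
  have hx : (splitFirstBit n x).2 = x 0 := rfl
  have hy : (splitFirstBit n y).2 = y 0 := rfl
  rw [hx, hy]
  generalize x 0 = i, y 0 = j
  generalize (splitFirstBit n x).1 = u, (splitFirstBit n y).1 = v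
  by_cases hv : v = bitCompl u
  · have h := hammingDist_bitCompl u
    have huv : u ≠ v := by
      rintro rfl
      rw [← hv, hammingDist_self] at h
      omega
    rw [← hv] at h
    simp only [h, ← hv, huv]
    cases i <;> cases j <;> simp <;> omega
  · have h0 := hammingDist_eq_zero (x := u) (y := v)
    simp only [hv]
    cases i <;> cases j <;> simp [h0]

/-- The parity of the number of ones. -/
def bitParity (x : Fin n → Bool) : Bool := decide (Odd (∑ i, (x i).toNat))

/-- Bit by bit, `a + b = [a ≠ b] + 2ab`. -/
lemma sum_toNat_add (x y : Fin n → Bool) : ∑ i, (x i).toNat + ∑ i, (y i).toNat =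
    hammingDist x y + 2 * ∑ i, (x i && y i).toNat := by
  simp only [hammingDist, Finset.card_filter, Finset.mul_sum, ← Finset.sum_add_distrib]
  refine Finset.sum_congr rfl fun i _ => ?_
  cases x i <;> cases y i <;> simp

lemma bitParity_eq_iff (x y : Fin n → Bool) :
    bitParity y = bitParity x ↔ Even (hammingDist x y) := by
  have h := sum_toNat_add x y
  simp only [bitParity, decide_eq_decide, Nat.odd_iff, Nat.even_iff]
  omega

/-- The two copies of an edge of the folded hypercube cross only if the edge is complementary and
`n` is odd. -/
lemma mem_twistedEdges_foldedHypercube (hn : 2 ≤ n) (D : BookDrawing (foldedHypercube n))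
    {t : (Fin n → Bool) × (Fin n → Bool)}
    (ht : t ∈ D.twistedEdges bitParity (fun u v => decide (v = bitCompl u))) :
    Odd n ∧ t.2 = bitCompl t.1 ∧ D.pos t.1 < D.pos (bitCompl t.1) := by
  obtain ⟨u, v⟩ := t
  simp only [BookDrawing.twistedEdges, Finset.mem_filter, Finset.mem_univ, true_and,
    foldedHypercube_adj_iff (show n ≠ 0 by omega)] at ht ⊢
  obtain ⟨h1, h2, h3⟩ := ht
  have hp := bitParity_eq_iff u v
  by_cases hv : v = bitCompl u
  · rw [hv, hammingDist_bitCompl] at hp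
    refine ⟨?_, hv, hv ▸ h2⟩
    rw [← Nat.not_even_iff_odd, ← hp, ← hv, h3]
    cases bitParity u <;> simp [hv]
  · rw [h1.resolve_right hv] at hp
    simp [hv] at h3
    simp [h3] at hp

/-- Twisted edges are complementary, hence part of a perfect matching; listed with the earlier end
first, their first and second ends are disjoint sets of vertices. -/
lemma two_mul_card_twistedEdges_le (hn : 2 ≤ n) (D : BookDrawing (foldedHypercube n)) :
    2 * (D.twistedEdges bitParity (fun u v => decide (v = bitCompl u))).card ≤ 2 ^ n := by
  classical
  set T := D.twistedEdges bitParity (fun u v => decide (v = bitCompl u)) with hT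
  have h1 : (T.image Prod.fst).card = T.card := by
    refine Finset.card_image_of_injOn fun t ht t' ht' h => ?_
    have k := (mem_twistedEdges_foldedHypercube hn D ht).2.1
    have k' := (mem_twistedEdges_foldedHypercube hn D ht').2.1
    exact Prod.ext h (by rw [k, k', h])
  have h2 : (T.image Prod.snd).card = T.card := by
    refine Finset.card_image_of_injOn fun t ht t' ht' h => ?_
    have k := (mem_twistedEdges_foldedHypercube hn D ht).2.1
    have k' := (mem_twistedEdges_foldedHypercube hn D ht').2.1
    have h' : t.2 = t'.2 := h
    refine Prod.ext ?_ h
    rw [← bitCompl_bitCompl t.1, ← k, h', k', bitCompl_bitCompl]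
  have h3 : Disjoint (T.image Prod.fst) (T.image Prod.snd) := by
    rw [Finset.disjoint_left]
    intro v hv hv'
    obtain ⟨t, ht, rfl⟩ := Finset.mem_image.1 hv
    obtain ⟨t', ht', h⟩ := Finset.mem_image.1 hv'
    have k := (mem_twistedEdges_foldedHypercube hn D ht).2.2
    obtain ⟨-, k1, k2⟩ := mem_twistedEdges_foldedHypercube hn D ht'
    rw [← h, k1, bitCompl_bitCompl] at k
    omega
  have h4 := Finset.card_le_univ (T.image Prod.fst ∪ T.image Prod.snd)
  rw [Finset.card_union_of_disjoint h3, h1, h2] at h4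
  simp at h4
  omega

end FoldedHypercube

namespace BookDrawing

/-- The crossings of a drawing are counted by the crossing pairs in any list that holds the ends
and the page of every edge. -/
lemma card_crossingQuads_le_length {V : Type*} [Fintype V] {G : SimpleGraph V} (D : BookDrawing G)
    (L : List (ℕ × ℕ × Bool))
    (hL : ∀ a b, G.Adj a b → D.pos a < D.pos b → (D.pos a, D.pos b, D.page a b) ∈ L) :
    D.crossingQuads.card ≤ ((L.product L).filter fun t => decide (t.1.1 < t.2.1 ∧
      t.2.1 < t.1.2.1 ∧ t.1.2.1 < t.2.2.1 ∧ t.1.2.2 = t.2.2.2)).length := by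
  classical
  refine le_trans ?_ (List.toFinset_card_le _)
  refine Finset.card_le_card_of_injOn (fun q => ((D.pos q.1, D.pos q.2.1, D.page q.1 q.2.1),
    (D.pos q.2.2.1, D.pos q.2.2.2, D.page q.2.2.1 q.2.2.2))) ?_ ?_
  · rintro ⟨a, b, c, d⟩ h
    simp only [crossingQuads, Finset.coe_filter, Finset.mem_univ, true_and,
      Set.mem_ofPred_eq] at h
    obtain ⟨h1, h2, h3, h4, h5, h6⟩ := h
    simp only [List.coe_toFinset, Set.mem_ofPred_eq, List.mem_filter, decide_eq_true_eq]
    exact ⟨List.pair_mem_product.2 ⟨hL _ _ h1 (h3.trans h4), hL _ _ h2 (h4.trans h5)⟩,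
      h3, h4, h5, h6⟩
  · rintro ⟨a, b, c, d⟩ - ⟨a', b', c', d'⟩ - h
    simp only [Prod.mk.injEq, D.pos_injective.eq_iff] at h ⊢
    tauto

end BookDrawing

/-! ### Explicit drawings in dimensions three and four -/

/-- The number with the given binary digits, the least significant first. -/
def bitsToNat {n : ℕ} (x : Fin n → Bool) : ℕ := ∑ i : Fin n, 2 ^ (i : ℕ) * (x i).toNat

/-- The arcs above the spine in a drawing of `foldedHypercube 3`. -/
def upperArcsThree : List (ℕ × ℕ) :=
  [(0, 1), (0, 3), (1, 2), (2, 7), (3, 6), (4, 5), (4, 7), (5, 6)]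

/-- The arcs below the spine in a drawing of `foldedHypercube 3`. -/
def lowerArcsThree : List (ℕ × ℕ) :=
  [(0, 5), (0, 7), (1, 4), (1, 6), (2, 3), (2, 5), (3, 4), (6, 7)]

/-- A drawing of `foldedHypercube 3` with four crossings. -/
def bookDrawingThree : BookDrawing (foldedHypercube 3) where
  pos v := [6, 7, 1, 4, 3, 0, 2, 5].getD (bitsToNat v) 0
  page u v :=
    let i := [6, 7, 1, 4, 3, 0, 2, 5].getD (bitsToNat u) 0
    let j := [6, 7, 1, 4, 3, 0, 2, 5].getD (bitsToNat v) 0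
    upperArcsThree.contains (min i j, max i j)
  pos_injective := by unfold Function.Injective; decide +kernel
  page_comm u v := by simp only [min_comm, max_comm]

lemma card_crossingQuads_bookDrawingThree : bookDrawingThree.crossingQuads.card ≤ 4 := by
  refine (bookDrawingThree.card_crossingQuads_le_length (upperArcsThree.map (fun p =>
    (p.1, p.2, true)) ++ lowerArcsThree.map (fun p => (p.1, p.2, false))) ?_).trans ?_
  · simp only [foldedHypercube_adj_iff (show 3 ≠ 0 by norm_num), ← List.contains_iff_mem]
    decide +kernel
  · decide +kernel

/-- The arcs above the spine in a drawing of `foldedHypercube 4`. -/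
def upperArcsFour : List (ℕ × ℕ) :=
  [(0, 1), (0, 2), (1, 14), (2, 11), (2, 13), (3, 10), (3, 12), (4, 11), (4, 13), (5, 7), (5, 10),
    (5, 12), (6, 7), (6, 9), (8, 9), (8, 10), (13, 15), (14, 15)]

/-- The arcs below the spine in a drawing of `foldedHypercube 4`. -/
def lowerArcsFour : List (ℕ × ℕ) :=
  [(0, 5), (0, 9), (0, 15), (1, 3), (1, 4), (1, 8), (2, 3), (2, 7), (3, 6), (4, 5), (4, 6), (6, 15),
    (7, 8), (7, 14), (8, 13), (9, 11), (9, 12), (10, 11), (10, 15), (11, 14), (12, 13), (12, 14)]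

/-- A balanced drawing of `foldedHypercube 4` with 32 crossings. -/
def bookDrawingFour : BookDrawing (foldedHypercube 4) where
  pos v := [0, 15, 1, 14, 9, 6, 8, 7, 2, 13, 3, 12, 11, 4, 10, 5].getD (bitsToNat v) 0
  page u v :=
    let i := [0, 15, 1, 14, 9, 6, 8, 7, 2, 13, 3, 12, 11, 4, 10, 5].getD (bitsToNat u) 0
    let j := [0, 15, 1, 14, 9, 6, 8, 7, 2, 13, 3, 12, 11, 4, 10, 5].getD (bitsToNat v) 0
    upperArcsFour.contains (min i j, max i j)
  pos_injective := by unfold Function.Injective; decide +kernel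
  page_comm u v := by simp only [min_comm, max_comm]

/-- The value 32 is exactly what the theorem allows for `n = 4`; doubling the drawing for `n = 3`
would give the bound 36 only. -/
lemma card_crossingQuads_bookDrawingFour : bookDrawingFour.crossingQuads.card ≤ 32 := by
  refine (bookDrawingFour.card_crossingQuads_le_length (upperArcsFour.map (fun p =>
    (p.1, p.2, true)) ++ lowerArcsFour.map (fun p => (p.1, p.2, false))) ?_).trans ?_
  · simp only [foldedHypercube_adj_iff (show 4 ≠ 0 by norm_num), ← List.contains_iff_mem]
    decide +kernel
  · decide +kernel

lemma isBalanced_bookDrawingFour : bookDrawingFour.IsBalanced 5 := by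
  -- A decidable form of adjacency lets the kernel evaluate the degrees.
  have h : ∀ v β, bookDrawingFour.pageNeighbors v β = Finset.univ.filter fun p =>
      (hammingDist v p = 1 ∨ p = bitCompl v) ∧ bookDrawingFour.page v p = β := by
    intro v β
    ext p
    simp [BookDrawing.pageNeighbors, foldedHypercube_adj_iff (show 4 ≠ 0 by norm_num)]
  unfold BookDrawing.IsBalanced
  simp only [h]
  decide +kernel

/-! ### The recurrence and the final bound -/

lemma choose_two_add_choose_succ_two (k : ℕ) : k.choose 2 + (k + 1).choose 2 = k ^ 2 := by
  induction k with
  | zero => rfl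
  | succ k ih =>
    have h1 := Nat.choose_succ_succ (k + 1) 1
    have h2 := Nat.choose_succ_succ k 1
    simp only [Nat.choose_one_right, Nat.succ_eq_add_one] at h1 h2
    norm_num at h1 h2
    nlinarith

/-- Equality holds: four times the balanced sum is `n^2` for even `n` and `n^2 - 1` for odd `n`. -/
lemma four_mul_choose_two_balanced_le (n : ℕ) :
    4 * (((n + 1) / 2).choose 2 + ((n + 1 + 1) / 2).choose 2) + n % 2 ≤ n ^ 2 := by
  obtain ⟨k, rfl | rfl⟩ := Nat.even_or_odd' n
  · rw [show (2 * k + 1) / 2 = k by omega, show (2 * k + 1 + 1) / 2 = k + 1 by omega,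
      choose_two_add_choose_succ_two, show 2 * k % 2 = 0 by omega]
    nlinarith
  · have h1 := choose_two_add_choose_succ_two k
    have h2 := Nat.choose_succ_succ k 1
    simp only [Nat.choose_one_right, Nat.succ_eq_add_one] at h2
    norm_num at h2
    rw [show (2 * k + 1 + 1) / 2 = k + 1 by omega, show (2 * k + 1 + 1 + 1) / 2 = k + 1 by omega,
      show (2 * k + 1) % 2 = 1 by omega]
    nlinarith

/-- For `n ≥ 4` the folded hypercube has a balanced book drawing with few crossings. -/
theorem exists_bookDrawing_foldedHypercube (n : ℕ) (hn : 4 ≤ n) :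
    ∃ D : BookDrawing (foldedHypercube n), D.IsBalanced (n + 1) ∧
      32 * D.crossingQuads.card + 4 * (n ^ 2 + 3 * n) * 2 ^ n ≤ 11 * 4 ^ n := by
  induction n, hn using Nat.le_induction with
  | base =>
    refine ⟨bookDrawingFour, isBalanced_bookDrawingFour, ?_⟩
    have := card_crossingQuads_bookDrawingFour
    generalize bookDrawingFour.crossingQuads.card = K at *
    norm_num
    omega
  | succ n hn ih =>
    obtain ⟨D, hD, hK⟩ := ih
    have hH := isTwistedDouble_foldedHypercube (n := n) (by omega)
    refine ⟨_, hD.double (σ := bitParity) hH, ?_⟩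
    refine le_trans (Nat.add_le_add_right (Nat.mul_le_mul_left _
      (D.card_crossingQuads_double_le hH)) _) ?_
    have hF := hD.card_forks_le
    have hc := four_mul_choose_two_balanced_le n
    rw [Fintype.card_fun, Fintype.card_bool, Fintype.card_fin] at hF
    set T := D.twistedEdges bitParity (fun u v => decide (v = bitCompl u)) with hT
    have hT1 : 2 * T.card ≤ 2 ^ n := two_mul_card_twistedEdges_le (by omega) D
    have hT2 : Even n → T.card = 0 := by
      intro he
      rw [Finset.card_eq_zero, Finset.eq_empty_iff_forall_notMem]
      intro t ht
      exact Nat.not_even_iff_odd.2 (mem_twistedEdges_foldedHypercube (by omega) D ht).1 he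
    generalize ((n + 1) / 2).choose 2 + ((n + 1 + 1) / 2).choose 2 = c at *
    -- This is what the claim for `n + 1` requires beyond four times the induction hypothesis.
    have hstep : 4 * D.forks.card + 4 * T.card + 4 * 2 ^ n ≤ (n ^ 2 + n) * 2 ^ n := by
      rcases Nat.even_or_odd n with he | ho
      · rw [hT2 he]
        have h4 : 4 * c + 4 ≤ n ^ 2 + n := by omega
        have := Nat.mul_le_mul_right (2 ^ n) h4
        nlinarith
      · have h5 : n ≠ 4 := by rintro rfl; exact absurd ho (by decide)
        have h6 := Nat.odd_iff.1 ho
        have h4 : 4 * c + 6 ≤ n ^ 2 + n := by omega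
        have := Nat.mul_le_mul_right (2 ^ n) h4
        nlinarith
    have e1 : (4 : ℕ) ^ (n + 1) = 4 * 4 ^ n := by ring
    have e2 : (2 : ℕ) ^ (n + 1) = 2 * 2 ^ n := by ring
    rw [e1, e2]
    nlinarith

theorem theorem2p1 (n : ℕ) (hn : 3 ≤ n) :
    ∃ k : ℕ, crossingNumber (foldedHypercube n) = (k : ℕ∞) ∧
      (k : ℝ) ≤ 11 / 32 * 4 ^ n - ((n : ℝ) ^ 2 + 3 * (n : ℝ)) * 2 ^ (n - 3) := by
  obtain ⟨D, hD⟩ : ∃ D : BookDrawing (foldedHypercube n),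
      32 * D.crossingQuads.card + 4 * (n ^ 2 + 3 * n) * 2 ^ n ≤ 11 * 4 ^ n := by
    rcases hn.eq_or_lt with rfl | h
    · refine ⟨bookDrawingThree, ?_⟩
      have := card_crossingQuads_bookDrawingThree
      generalize bookDrawingThree.crossingQuads.card = K at *
      norm_num
      omega
    · obtain ⟨D, -, hD⟩ := exists_bookDrawing_foldedHypercube n h
      exact ⟨D, hD⟩
  have hle := D.crossingNumber_le
  obtain ⟨k, hk⟩ := ENat.ne_top_iff_exists.1 (ne_top_of_le_ne_top (ENat.natCast_ne_top _) hle)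
  refine ⟨k, hk.symm, ?_⟩
  rw [← hk, Nat.cast_le] at hle
  have h1 : 32 * k + 4 * (n ^ 2 + 3 * n) * 2 ^ n ≤ 11 * 4 ^ n :=
    le_trans (by omega) hD
  have h2 : (2 : ℝ) ^ n = 8 * 2 ^ (n - 3) := by
    obtain ⟨m, rfl⟩ := Nat.exists_eq_add_of_le hn
    rw [Nat.add_sub_cancel_left, pow_add]
    norm_num
  have h3 : (32 : ℝ) * k + 4 * ((n : ℝ) ^ 2 + 3 * n) * 2 ^ n ≤ 11 * 4 ^ n := by exact_mod_cast h1
  rw [h2] at h3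
  linarith
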